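/- Let $\mathbb{F}_q$ be a finite field with $q$ odd and $q\ge 13$, and let $k$ be an integer with $3\le k\le \frac{q-1}{2}-2$. For an integer $n>k$, pairwise distinct $\alpha_1,\dots,\alpha_n\in\mathbb{F}_q$ and $\eta\in\mathbb{F}_q$, the twisted Reed--Solomon code with one twist $t=1$ and hook $h=0$ is $$\mathcal{C}^{n,k}_{\alpha,1,0,\eta}=\Big\{\big(f(\alpha_1),\dots,f(\alpha_n)\big) : f=\sum_{i=0}^{k-1}f_iX^i+\eta f_0X^{k},\ f_0,\dots,f_{k-1}\in\mathbb{F}_q\Big\}\subseteq\mathbb{F}_q^n .$$ A linear code of length $n$, dimension $k$ and minimum Hamming distance $d$ is MDS if $d=n-k+1$. The code $\mathcal{C}^{n,k}_{\alpha,1,0,\eta}$ is called $(*)$-twisted if there is a proper subgroup $G$ of $(\mathbb{F}_q^*,\cdot)$ such that $\alpha_i\in G\cup\{0\}$ for all $i$, $\eta\neq0$, and $(-1)^k\eta^{-1}\in\mathbb{F}_q^*\setminus G$. 1. If $n>\frac{q+1}{2}$, then $\mathcal{C}^{n,k}_{\alpha,1,0,\eta}$ is not MDS, for any choice of pairwise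 distinct $\alpha_1,\dots,\alpha_n\in\mathbb{F}_q$ and any $\eta\in\mathbb{F}_q\setminus\{0\}$. 2. There is a $(*)$-twisted code of length $\frac{q+1}{2}$ and dimension $k$ that is MDS. Hence $\frac{q+1}{2}$ is the maximal length of an MDS twisted Reed--Solomon code of dimension $k$ with one twist $t=1$, hook $h=0$ and $\eta\ne0$, and it is attained by a $(*)$-twisted code. -/

import Mathlib

open Polynomial

noncomputable section

/-- The minimum distance of a code: the least Hamming distance between two distinct codewords. -/
def minDist {F : Type*} [Field F] [DecidableEq F] {n : ℕ} (C : Submodule F (Fin n → F)) : ℕ :=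
  sInf {d : ℕ | ∃ x ∈ C, ∃ y ∈ C, x ≠ y ∧ hammingDist x y = d}

/-- A linear code of length `n` is MDS if its minimum distance `d` and dimension `k`
meet the Singleton bound, `d = n - k + 1`; this is written without subtraction. -/
def IsMDS {F : Type*} [Field F] [DecidableEq F] {n : ℕ} (C : Submodule F (Fin n → F)) : Prop :=
  minDist C + Module.finrank F C = n + 1

/-- The evaluation map `f ↦ [f(α₁), …, f(αₙ)]`. -/
def evalMap {F : Type*} [Field F] {n : ℕ} (α : Fin n → F) : F[X] →ₗ[F] (Fin n → F) :=
  LinearMap.pi fun i => Polynomial.leval (α i)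

/-- The data defining a twisted Reed--Solomon code of length `n` and dimension `k`
with `ℓ` twists over `F`. -/
structure TwistedRSParams (F : Type*) [Field F] (n k ℓ : ℕ) where
  k_pos : 0 < k
  k_lt_n : k < n
  ℓ_pos : 0 < ℓ
  /-- evaluation points -/
  α : Fin n → F
  α_injective : Function.Injective α
  /-- twist vector, with entries in `{1, …, n - k}` -/
  t : Fin ℓ → ℕ
  one_le_t : ∀ j, 1 ≤ t j
  t_le : ∀ j, t j ≤ n - k
  /-- hook vector, with entries in `{0, …, k - 1}` -/
  h : Fin ℓ → Fin k
  /-- coefficient vector -/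
  η : Fin ℓ → F
  ht_injective : Function.Injective fun j => (h j, t j)

namespace TwistedRSParams

/-- The space of twisted polynomials
`∑_{i < k} f_i X^i + ∑_j η_j f_{h_j} X^{k - 1 + t_j}`. -/
def twistedPolys {F : Type*} [Field F] {n k ℓ : ℕ} (D : TwistedRSParams F n k ℓ) :
    Submodule F F[X] where
  carrier := {p | ∃ f : Fin k → F,
    p = ∑ i : Fin k, C (f i) * X ^ (i : ℕ) + ∑ j : Fin ℓ, C (D.η j * f (D.h j)) * X ^ (k - 1 + D.t j)}
  zero_mem' := ⟨0, by simp⟩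
  add_mem' := by
    rintro _ _ ⟨f, rfl⟩ ⟨g, rfl⟩
    refine ⟨f + g, ?_⟩
    simp only [Pi.add_apply, mul_add, map_add, add_mul, Finset.sum_add_distrib]
    ring
  smul_mem' := by
    rintro c _ ⟨f, rfl⟩
    refine ⟨c • f, ?_⟩
    simp only [Pi.smul_apply, smul_eq_mul, Polynomial.smul_eq_C_mul, mul_add, Finset.mul_sum,
      map_mul]
    congr 1 <;> refine Finset.sum_congr rfl fun i _ => ?_ <;> ring

/-- The twisted Reed--Solomon code. -/
def code {F : Type*} [Field F] {n k ℓ : ℕ} (D : TwistedRSParams F n k ℓ) :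
    Submodule F (Fin n → F) :=
  D.twistedPolys.map (evalMap D.α)

/-- One twist, with `t = 1` and `h = 0`. -/
def IsTwistOneHookZero {F : Type*} [Field F] {n k : ℕ} (D : TwistedRSParams F n k 1) : Prop :=
  D.t 0 = 1 ∧ (D.h 0 : ℕ) = 0

/-- The `(∗)`-twisted codes: `t = 1`, `h = 0`, and for some proper subgroup `G` of the
multiplicative group of `F`, all evaluation points lie in `G ∪ {0}` and
`(-1)^k η⁻¹` is a nonzero element outside `G`. -/
def IsStarTwisted {F : Type*} [Field F] {n k : ℕ} (D : TwistedRSParams F n k 1) : Prop :=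
  D.IsTwistOneHookZero ∧
    ∃ G : Subgroup Fˣ, G ≠ ⊤ ∧ (∀ i, D.α i = 0 ∨ ∃ g ∈ G, D.α i = (g : F)) ∧
      ∃ u : Fˣ, u ∉ G ∧ (u : F) = (-1) ^ k * (D.η 0)⁻¹

end TwistedRSParams

end

/-!
A codeword with `k` zeros comes from a scalar multiple of `∏ a ∈ T, (X - a)` for some set `T` of `k`
evaluation points, and this product is a twisted polynomial iff `∏ a ∈ T, a = (-1) ^ k η⁻¹`. So the
code is MDS iff `(-1) ^ k η⁻¹` is not a product of `k` distinct evaluation points. For a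
`(∗)`-twisted code these products lie in `G ∪ {0}`, and `G ∪ {0}` with `G` the group of squares has
`(q + 1) / 2` elements.

Conversely, more than `(q - 1) / 2` nonzero points represent every `g` as a product of `k` of them.
Take `k - j` squares and `j` nonsquares, with `j` even iff `g` is a square. By pigeonhole in the
relevant coset of the squares it suffices that the two sets of partial products have together more
than `(q - 1) / 2` elements. This holds because in a cyclic group a set `A` has at least `|A|`
products of `j` distinct elements when `1 ≤ j < |A|`: in a minimal counterexample there are exactly
`|A| - 1` products, and any two of their translates by inverses of elements of `A` overlap in at
least `|A| - 2` points. Counting quotients then makes `A` a coset of a subgroup all of whose `j`-th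
powers are trivial, so that `|A|` divides `j`. If at most two of the points lie in one of the two
cosets of the squares, then almost all of the other coset is available, and pigeonhole applies
there.
-/

section

open Finset MulAction
open scoped Pointwise

section SubsetProds

section CommMonoid

variable {M : Type*} [CommMonoid M] [DecidableEq M] {i j : ℕ} {A B : Finset M} {a b g : M}

/-- The set of products of `j` distinct elements of `A`, i.e. the `j`-fold restricted product set
of additive combinatorics. -/
def subsetProds (j : ℕ) (A : Finset M) : Finset M :=
  (A.powersetCard j).image fun T => ∏ x ∈ T, x

lemma mem_subsetProds : g ∈ subsetProds j A ↔ ∃ T ⊆ A, #T = j ∧ ∏ x ∈ T, x = g := by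
  simp [subsetProds, mem_powersetCard, and_assoc]

lemma subsetProds_mono (h : A ⊆ B) : subsetProds j A ⊆ subsetProds j B :=
  image_subset_image (powersetCard_mono h)

lemma subsetProds_one (A : Finset M) : subsetProds 1 A = A := by
  simp [subsetProds, powersetCard_one, map_eq_image, image_image, Function.comp_def]

lemma mul_mem_subsetProds_union (hAB : Disjoint A B) (ha : a ∈ subsetProds i A)
    (hb : b ∈ subsetProds j B) : a * b ∈ subsetProds (i + j) (A ∪ B) := by
  obtain ⟨T, hT, rfl, rfl⟩ := mem_subsetProds.1 ha
  obtain ⟨U, hU, rfl, rfl⟩ := mem_subsetProds.1 hb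
  have hTU : Disjoint T U := disjoint_of_subset_left hT (disjoint_of_subset_right hU hAB)
  exact mem_subsetProds.2
    ⟨T ∪ U, union_subset_union hT hU, card_union_of_disjoint hTU, prod_union hTU⟩

lemma mul_mem_subsetProds_insert (ha : a ∉ A) (hb : b ∈ subsetProds j A) :
    a * b ∈ subsetProds (j + 1) (insert a A) := by
  rw [add_comm, insert_eq]
  exact mul_mem_subsetProds_union (disjoint_singleton_left.2 ha) (by simp [subsetProds_one]) hb

lemma mem_of_mem_subsetProds {S : Type*} [SetLike S M] [SubmonoidClass S M] {H : S}
    (hA : ∀ a ∈ A, a ∈ H) (hg : g ∈ subsetProds j A) : g ∈ H := by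
  obtain ⟨T, hT, -, rfl⟩ := mem_subsetProds.1 hg
  exact prod_mem fun x hx => hA x (hT hx)

lemma mem_subsetProds_preimage_val {u : Mˣ} :
    u ∈ subsetProds j (A.preimage Units.val Units.val_injective.injOn) ↔
      (u : M) ∈ subsetProds j A := by
  classical
  simp only [mem_subsetProds]
  constructor
  · rintro ⟨T, hT, hTj, rfl⟩
    refine ⟨T.map ⟨Units.val, Units.val_injective⟩, ?_, by simpa using hTj, by simp⟩
    intro x hx
    obtain ⟨v, hv, rfl⟩ := mem_map.1 hx
    exact mem_preimage.1 (hT hv)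
  · rintro ⟨T, hT, hTj, hTu⟩
    have hunit : ∀ x ∈ T, x ∈ Set.range (Units.val : Mˣ → M) := fun x hx =>
      isUnit_of_dvd_unit (dvd_prod_of_mem _ hx) (hTu ▸ u.isUnit)
    refine ⟨T.preimage Units.val Units.val_injective.injOn,
      fun v hv => mem_preimage.2 (hT (mem_preimage.1 hv)), ?_, Units.ext ?_⟩
    · rw [card_preimage, filter_true_of_mem hunit, hTj]
    · rw [Units.coe_prod, prod_preimage _ _ _ (fun x => x) fun x hx hx' => absurd (hunit x hx) hx',
        hTu]

end CommMonoid

section Group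

variable {G : Type*} [Group G] {H : Subgroup G} {A B S : Finset G} {g : G}

lemma card_le_natCard_of_forall_mem [Finite H] (hA : ∀ a ∈ A, a ∈ H) : #A ≤ Nat.card H := by
  rw [← SetLike.coe_sort_coe, Nat.card_coe_set_eq, ← Set.ncard_coe_finset]
  exact Set.ncard_le_ncard hA

variable [DecidableEq G]

lemma card_add_card_le_convolution_add_natCard [Finite H] (hA : ∀ a ∈ A, a ∈ H)
    (hB : ∀ b ∈ B, g / b ∈ H) : #A + #B ≤ A.convolution B g + Nat.card H := by
  rw [← card_inter_smul_inv, ← card_inv B, ← card_smul_finset g B⁻¹, ← card_union_add_card_inter,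
    add_comm]
  gcongr
  refine card_le_natCard_of_forall_mem fun a ha => ?_
  obtain ha | ha := mem_union.1 ha
  · exact hA a ha
  · obtain ⟨b, hb, rfl⟩ := mem_smul_finset.1 ha
    simpa using hB b⁻¹ (mem_inv'.1 hb)

lemma mem_mul_of_natCard_lt [Finite H] (hA : ∀ a ∈ A, a ∈ H) (hB : ∀ b ∈ B, g / b ∈ H)
    (h : Nat.card H < #A + #B) : g ∈ A * B := by
  have := card_add_card_le_convolution_add_natCard hA hB
  exact convolution_pos.1 (by lia)

lemma sum_convolution_le (D A B : Finset G) : ∑ x ∈ D, A.convolution B x ≤ #A * #B := by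
  rw [← card_product]
  exact (sum_card_fiberwise_eq_card_filter (A ×ˢ B) D fun ab => ab.1 * ab.2).trans_le
    (card_filter_le _ _)

/-- The correlations of `S` sum up to `|S| ^ 2`, and the quotients `x / y` with `y ∈ A` already
account for all of that. -/
lemma singleton_div_eq_div_self (hA : 3 ≤ #A) (hS : #S + 1 = #A)
    (hcorr : ∀ x ∈ A, ∀ y ∈ A, x ≠ y → #A ≤ S.convolution S⁻¹ (x / y) + 2) {x : G} (hx : x ∈ A) :
    {x} / A = S / S := by
  have hone : S.convolution S⁻¹ 1 = #S := by rw [← card_inter_smul, one_smul, inter_self]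
  have hpos : ∀ d, 0 < S.convolution S⁻¹ d ↔ d ∈ S / S := fun d => by
    rw [convolution_pos, div_eq_mul_inv]
  rw [singleton_div]
  refine Subset.antisymm (image_subset_iff.2 fun y hy => (hpos _).1 ?_) fun d hd => ?_
  · obtain rfl | hxy := eq_or_ne x y
    · rw [div_self', hone]
      lia
    · have := hcorr x hx y hy hxy
      lia
  · by_contra hdA
    have hsum := sum_convolution_le (insert d (A.image (x / ·))) S S⁻¹
    rw [sum_insert hdA, sum_image div_right_injective.injOn, ← add_sum_erase A _ hx, div_self',
      hone, card_inv] at hsum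
    have hrest : #(A.erase x) * (#S - 1) ≤ ∑ y ∈ A.erase x, S.convolution S⁻¹ (x / y) :=
      card_nsmul_le_sum _ _ _ fun y hy => by
        have := hcorr x hx y (mem_of_mem_erase hy) (ne_of_mem_erase hy).symm
        lia
    have hd' := (hpos d).2 hd
    obtain ⟨m, hm⟩ : ∃ m, #S = m + 1 := ⟨#S - 1, by lia⟩
    rw [card_erase_of_mem hx, ← hS, hm, Nat.add_sub_cancel, Nat.add_sub_cancel] at hrest
    rw [hm] at hsum
    nlinarith

end Group

section CommGroup

variable {G : Type*} [CommGroup G] [DecidableEq G] {j : ℕ} {A D : Finset G} {g : G}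

lemma prod_div_mem_subsetProds_card_sub (hg : g ∈ subsetProds j A) :
    (∏ x ∈ A, x) / g ∈ subsetProds (#A - j) A := by
  obtain ⟨T, hT, rfl, rfl⟩ := mem_subsetProds.1 hg
  exact mem_subsetProds.2 ⟨A \ T, sdiff_subset, card_sdiff_of_subset hT,
    eq_div_of_mul_eq' (prod_sdiff hT)⟩

lemma card_subsetProds_le_card_subsetProds_card_sub (j : ℕ) (A : Finset G) :
    #(subsetProds j A) ≤ #(subsetProds (#A - j) A) :=
  card_le_card_of_injOn _ (fun _ => prod_div_mem_subsetProds_card_sub) div_right_injective.injOn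

lemma pow_mul_mem_subsetProds_smul (c : G) (hg : g ∈ subsetProds j A) :
    c ^ j * g ∈ subsetProds j (c • A) := by
  obtain ⟨T, hT, rfl, rfl⟩ := mem_subsetProds.1 hg
  refine mem_subsetProds.2 ⟨c • T, smul_finset_subset_smul_finset hT, card_smul_finset c T, ?_⟩
  rw [← image_smul, prod_image (MulAction.injective c).injOn]
  simp only [smul_eq_mul]
  rw [prod_mul_distrib, prod_const]

lemma coe_stabilizer_eq_of_forall_singleton_div_eq (hA : A.Nonempty)
    (h : ∀ x ∈ A, {x} / A = D) : (stabilizer G A : Set G) = D := by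
  simp only [singleton_div] at h
  obtain ⟨x, hx⟩ := hA
  ext d
  rw [SetLike.mem_coe, mem_coe]
  constructor
  · intro hd
    have hdx : d⁻¹ * x ∈ A := mem_stabilizer_finset'.1 (inv_mem hd) hx
    rw [← h x hx]
    exact mem_image.2 ⟨_, hdx, by simp [div_eq_mul_inv]⟩
  · rw [← h x hx]
    intro hd
    obtain ⟨y, hy, rfl⟩ := mem_image.1 hd
    refine mem_stabilizer_finset'.2 fun b hb => ?_
    have hyb : y / b ∈ A.image (x / ·) := by
      rw [h x hx, ← h y hy]
      exact mem_image_of_mem _ hb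
    obtain ⟨c, hc, hcb⟩ := mem_image.1 hyb
    have hxb : x / y * b = c := by
      rw [div_mul, ← hcb, div_div_cancel]
    rwa [smul_eq_mul, hxb]

lemma card_stabilizer_dvd_card (S : Finset G) : Nat.card (stabilizer G S) ∣ #S := by
  have h := Subgroup.card_mul_eq_card_subgroup_mul_card_quotient (stabilizer G (S : Set G)) S
  rw [mul_stabilizer_self, stabilizer_coe_finset, Nat.card_coe_set_eq, Set.ncard_coe_finset] at h
  exact ⟨_, h⟩

lemma pow_mem_stabilizer_subsetProds {c : G} (hc : c ∈ stabilizer G A) :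
    c ^ j ∈ stabilizer G (subsetProds j A) :=
  mem_stabilizer_finset'.2 fun _ hg => by
    simpa only [mem_stabilizer_iff.1 hc, smul_eq_mul] using pow_mul_mem_subsetProds_smul c hg

/-- The `j`-th powers of the stabilizer of `A` form a group whose order divides both `|A|` and
`|A| - 1`. -/
lemma pow_eq_one_of_mem_stabilizer (hA : Nat.card (stabilizer G A) = #A)
    (hS : #(subsetProds j A) + 1 = #A) {c : G} (hc : c ∈ stabilizer G A) : c ^ j = 1 := by
  set L : Subgroup G := (stabilizer G A).map (powMonoidHom j)
  have hLS : L ≤ stabilizer G (subsetProds j A) := by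
    rintro _ ⟨d, hd, rfl⟩
    exact pow_mem_stabilizer_subsetProds hd
  have hdvdS : Nat.card L ∣ #(subsetProds j A) :=
    (Subgroup.card_dvd_of_le hLS).trans (card_stabilizer_dvd_card _)
  have hdvdA : Nat.card L ∣ #(subsetProds j A) + 1 := by
    rw [hS, ← hA]
    exact Subgroup.card_map_dvd _ _
  have hbot : L = ⊥ :=
    Subgroup.card_eq_one.1 (Nat.dvd_one.1 ((Nat.dvd_add_right hdvdS).1 hdvdA))
  exact Subgroup.mem_bot.1 (hbot ▸ Subgroup.mem_map_of_mem (powMonoidHom j) hc)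

lemma card_dvd_of_forall_singleton_div_eq [IsCyclic G] (hA : A.Nonempty)
    (hdiv : ∀ x ∈ A, {x} / A = D) (hS : #(subsetProds j A) + 1 = #A) : #A ∣ j := by
  obtain ⟨x, hx⟩ := hA
  have hstab : Nat.card (stabilizer G A) = #A := by
    rw [← SetLike.coe_sort_coe, coe_stabilizer_eq_of_forall_singleton_div_eq ⟨x, hx⟩ hdiv,
      Nat.card_coe_set_eq, Set.ncard_coe_finset, ← hdiv x hx, singleton_div,
      card_image_of_injective _ div_right_injective]
  rw [← hstab, ← IsCyclic.exponent_eq_card]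
  exact Monoid.exponent_dvd_of_forall_pow_eq_one fun c =>
    Subtype.ext (pow_eq_one_of_mem_stabilizer hstab hS c.2)

lemma card_subsetProds_erase_erase_le {x y : G} (hx : x ∈ A) (hy : y ∈ A) (hxy : x ≠ y) (j : ℕ) :
    #(subsetProds j ((A.erase x).erase y)) ≤
      (subsetProds (j + 1) A).convolution (subsetProds (j + 1) A)⁻¹ (x / y) := by
  have hmul : ∀ z ∈ A, z ∉ (A.erase x).erase y → ∀ p ∈ subsetProds j ((A.erase x).erase y),
      p ∈ z⁻¹ • subsetProds (j + 1) A := fun z hz hz' p hp =>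
    mem_inv_smul_finset_iff.2 <| subsetProds_mono
      (insert_subset hz ((erase_subset _ _).trans (erase_subset _ _)))
      (mul_mem_subsetProds_insert hz' hp)
  have h := card_smul_inter_smul (subsetProds (j + 1) A) (subsetProds (j + 1) A) x⁻¹ y⁻¹
  rw [inv_inv, ← div_eq_mul_inv] at h
  rw [← h]
  exact card_le_card fun p hp =>
    mem_inter.2 ⟨hmul x hx (by simp [hxy]) p hp, hmul y hy (by simp) p hp⟩

theorem card_le_card_subsetProds [IsCyclic G] (hj : 1 ≤ j) (hjA : j + 1 ≤ #A) :
    #A ≤ #(subsetProds j A) := by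
  induction A using Finset.strongInduction generalizing j with
  | H A ih =>
  rcases hj.eq_or_lt with rfl | hj2
  · rw [subsetProds_one]
  rcases hjA.eq_or_lt with hjn | hjn
  · have := card_subsetProds_le_card_subsetProds_card_sub 1 A
    rwa [subsetProds_one, ← hjn, Nat.add_sub_cancel, hjn] at this
  by_contra! hlt
  have hS : #(subsetProds j A) + 1 = #A := by
    obtain ⟨x, hx⟩ : A.Nonempty := card_pos.1 (by lia)
    have hcard := card_erase_of_mem hx
    have := (ih _ (erase_ssubset hx) hj (by lia)).trans
      (card_le_card (subsetProds_mono (A.erase_subset x)))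
    lia
  have hcorr : ∀ x ∈ A, ∀ y ∈ A, x ≠ y →
      #A ≤ (subsetProds j A).convolution (subsetProds j A)⁻¹ (x / y) + 2 := by
    intro x hx y hy hxy
    have hcard := card_erase_of_mem (mem_erase.2 ⟨hxy.symm, hy⟩)
    rw [card_erase_of_mem hx] at hcard
    have hih := ih ((A.erase x).erase y) ((erase_subset _ _).trans_ssubset (erase_ssubset hx))
      (j := j - 1) (by lia) (by lia)
    have hle := card_subsetProds_erase_erase_le hx hy hxy (j - 1)
    rw [Nat.sub_add_cancel hj] at hle
    lia
  have hdiv : ∀ x ∈ A, {x} / A = subsetProds j A / subsetProds j A := fun x hx =>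
    singleton_div_eq_div_self (by lia) hS hcorr hx
  have hdvd : #A ∣ j := card_dvd_of_forall_singleton_div_eq (card_pos.1 (by lia)) hdiv hS
  exact absurd (Nat.le_of_dvd hj hdvd) (by lia)

end CommGroup

section IndexTwo

variable {G : Type*} [CommGroup G] {H : Subgroup G} {S X Y : Finset G} {j k : ℕ} {g : G}

lemma prod_mem_iff_even_card (hH : H.index = 2) (hY : ∀ y ∈ Y, y ∉ H) :
    ∏ y ∈ Y, y ∈ H ↔ Even #Y := by
  classical
  induction Y using Finset.induction_on with
  | empty => simp
  | insert y T hy ih =>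
    rw [prod_insert hy, Subgroup.mul_mem_iff_of_index_two hH, card_insert_of_notMem hy,
      ih fun x hx => hY x (mem_insert_of_mem hx), Nat.even_add_one]
    simp [hY y (mem_insert_self y T)]

variable [DecidableEq G]

lemma card_filter_pow_eq_le [IsCyclic G] [Finite G] (A : Finset G) {n : ℕ} (hn : 0 < n) (g : G) :
    #{a ∈ A | a ^ n = g} ≤ n := by
  have := Fintype.ofFinite G
  obtain h | ⟨b, hb⟩ := {a ∈ A | a ^ n = g}.eq_empty_or_nonempty
  · simp [h]
  · refine le_trans (card_le_card_of_injOn (· / b) (fun a ha => ?_) div_left_injective.injOn)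
      (IsCyclic.card_pow_eq_one_le (α := G) hn)
    have ha := (mem_filter.1 ha).2
    simp [div_pow, ha, (mem_filter.1 hb).2]

lemma mem_subsetProds_two [IsCyclic G] [Finite G] (hX : ∀ x ∈ X, x ∈ H)
    (hc : Nat.card H + 3 ≤ 2 * #X) (hg : g ∈ H) : g ∈ subsetProds 2 X := by
  by_contra hgX
  have hdiag : ∀ x ∈ X, ∀ y ∈ X, x * y = g → x = y := by
    intro x hx y hy hxy
    by_contra hne
    exact hgX (mem_subsetProds.2 ⟨{x, y}, by simp [insert_subset_iff, hx, hy], card_pair hne,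
      by rw [prod_pair hne, hxy]⟩)
  have hconv : X.convolution X g ≤ #{x ∈ X | x ^ 2 = g} := by
    have hmem : ∀ p ∈ {p ∈ X ×ˢ X | p.1 * p.2 = g}, p.1 ∈ X ∧ p.1 = p.2 ∧ p.1 * p.2 = g := by
      intro p hp
      obtain ⟨hpX, hpg⟩ := mem_filter.1 hp
      obtain ⟨hp1, hp2⟩ := mem_product.1 hpX
      exact ⟨hp1, hdiag _ hp1 _ hp2 hpg, hpg⟩
    refine card_le_card_of_injOn Prod.fst (fun p hp => ?_) fun p hp q hq hpq => ?_
    · obtain ⟨hpX, hpp, hpg⟩ := hmem p hp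
      exact mem_filter.2 ⟨hpX, by rw [sq, ← hpg, ← hpp]⟩
    · exact Prod.ext hpq (by rw [← (hmem p hp).2.1, hpq, (hmem q hq).2.1])
  have hsq := card_filter_pow_eq_le X two_pos g
  have := card_add_card_le_convolution_add_natCard hX fun x hx => H.div_mem hg (hX x hx)
  lia

lemma mem_subsetProds_of_natCard_add_two_mul_le [IsCyclic G] [Finite G] (hX : ∀ x ∈ X, x ∈ H)
    (hj : 2 ≤ j) (hc : Nat.card H + 2 * j ≤ 2 * #X + 1) (hg : g ∈ H) : g ∈ subsetProds j X := by
  obtain ⟨U, hU, hUc⟩ := exists_subset_card_eq (show j - 2 ≤ #X by lia)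
  have hR := card_sdiff_of_subset hU
  have hpair : g / ∏ x ∈ U, x ∈ subsetProds 2 (X \ U) :=
    mem_subsetProds_two (fun x hx => hX x (mem_sdiff.1 hx).1) (by lia)
      (H.div_mem hg (H.prod_mem fun x hx => hX x (hU hx)))
  have := mul_mem_subsetProds_union sdiff_disjoint hpair
    (mem_subsetProds.2 ⟨U, Subset.rfl, hUc, rfl⟩)
  rwa [div_mul_cancel, sdiff_union_of_subset hU, Nat.add_sub_cancel' hj] at this

lemma mem_subsetProds_of_natCard_le_card_add_one [IsCyclic G] [Finite G] (hX : ∀ x ∈ X, x ∈ H)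
    (hc : Nat.card H ≤ #X + 1) (hj : 2 ≤ j) (hjX : j + 2 ≤ #X) (hg : g ∈ H) :
    g ∈ subsetProds j X := by
  obtain hle | hlt := le_or_gt (2 * j) #X
  · exact mem_subsetProds_of_natCard_add_two_mul_le hX hj (by lia) hg
  · have hcompl : (∏ x ∈ X, x) / g ∈ subsetProds (#X - j) X :=
      mem_subsetProds_of_natCard_add_two_mul_le hX (by lia) (by lia)
        (H.div_mem (H.prod_mem hX) hg)
    have := prod_div_mem_subsetProds_card_sub hcompl
    rwa [div_div_cancel, Nat.sub_sub_self (by lia)] at this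

lemma mem_subsetProds_union_of_natCard_lt [Finite H] (hH : H.index = 2)
    (hX : ∀ x ∈ X, x ∈ H) (hY : ∀ y ∈ Y, y ∉ H) (hjk : j ≤ k) (hg : g ∈ H ↔ Even j)
    (hc : Nat.card H < #(subsetProds (k - j) X) + #(subsetProds j Y)) :
    g ∈ subsetProds k (X ∪ Y) := by
  have hquot : ∀ b ∈ subsetProds j Y, g / b ∈ H := by
    intro b hb
    obtain ⟨T, hT, rfl, rfl⟩ := mem_subsetProds.1 hb
    rw [div_eq_mul_inv, Subgroup.mul_mem_iff_of_index_two hH, inv_mem_iff,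
      prod_mem_iff_even_card hH fun y hy => hY y (hT hy), hg]
  obtain ⟨a, ha, b, hb, rfl⟩ :=
    mem_mul.1 (mem_mul_of_natCard_lt (fun a => mem_of_mem_subsetProds hX) hquot hc)
  have hXY : Disjoint X Y := disjoint_left.2 fun x hx hy => hY x hy (hX x hx)
  simpa only [Nat.sub_add_cancel hjk] using mul_mem_subsetProds_union hXY ha hb

lemma mem_subsetProds_union_of_three_le_card [IsCyclic G] [Finite G] (hH : H.index = 2)
    (hX : ∀ x ∈ X, x ∈ H) (hY : ∀ y ∈ Y, y ∉ H) (hX3 : 3 ≤ #X) (hY3 : 3 ≤ #Y)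
    (hc : Nat.card H < #X + #Y) (hk : 3 ≤ k) (hkH : k + 2 ≤ Nat.card H) (g : G) :
    g ∈ subsetProds k (X ∪ Y) := by
  obtain ⟨l, hl1, hlY, hlk, hlX⟩ : ∃ l, 1 ≤ l ∧ l + 2 ≤ #Y ∧ l + 2 ≤ k ∧ k + 1 ≤ #X + l :=
    ⟨max 1 (k + 1 - #X), by lia⟩
  obtain ⟨j, hlj, hjl, hg⟩ : ∃ j, l ≤ j ∧ j ≤ l + 1 ∧ (g ∈ H ↔ Even j) := by
    by_cases hl : g ∈ H ↔ Even l
    · exact ⟨l, le_rfl, l.le_succ, hl⟩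
    · exact ⟨l + 1, l.le_succ, le_rfl, by rw [Nat.even_add_one]; tauto⟩
  refine mem_subsetProds_union_of_natCard_lt hH hX hY (by lia) hg (hc.trans_le ?_)
  exact add_le_add (card_le_card_subsetProds (by lia) (by lia))
    (card_le_card_subsetProds (by lia) (by lia))

lemma mem_subsetProds_union_of_card_le_two [IsCyclic G] [Finite G] (hH : H.index = 2)
    (hX : ∀ x ∈ X, x ∈ H) (hY : ∀ y ∈ Y, y ∉ H) (hY2 : #Y ≤ 2) (h6 : 6 ≤ Nat.card H)
    (hc : Nat.card H < #X + #Y) (hk : 3 ≤ k) (hkH : k + 2 ≤ Nat.card H) (g : G) :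
    g ∈ subsetProds k (X ∪ Y) := by
  have hXH := card_le_natCard_of_forall_mem hX
  by_cases hg : g ∈ H
  · obtain hkX | hkX := le_or_gt (k + 2) #X
    · exact subsetProds_mono subset_union_left
        (mem_subsetProds_of_natCard_le_card_add_one hX (by lia) (by lia) hkX hg)
    · have hY' : #Y = 2 := by lia
      have hquot : g / ∏ y ∈ Y, y ∈ subsetProds (k - 2) X := by
        refine mem_subsetProds_of_natCard_le_card_add_one hX (by lia) (by lia) (by lia)
          (H.div_mem hg ?_)
        rw [prod_mem_iff_even_card hH hY, hY']
        exact even_two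
      have hXY : Disjoint X Y := disjoint_left.2 fun x hx hy => hY x hy (hX x hx)
      have := mul_mem_subsetProds_union hXY hquot
        (mem_subsetProds.2 ⟨Y, Subset.rfl, hY', rfl⟩)
      rwa [div_mul_cancel, Nat.sub_add_cancel (by lia)] at this
  · refine mem_subsetProds_union_of_natCard_lt hH hX hY (j := 1) (by lia) (by simpa using hg) ?_
    have := card_le_card_subsetProds (A := X) (j := k - 1) (by lia) (by lia)
    rw [subsetProds_one]
    lia

lemma mem_subsetProds_of_three_le_card_filter_mem [IsCyclic G] [Finite G] [DecidablePred (· ∈ H)]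
    (hH : H.index = 2) (h6 : 6 ≤ Nat.card H) (hS3 : 3 ≤ #{x ∈ S | x ∈ H})
    (hS : Nat.card H < #S) (hk : 3 ≤ k) (hkH : k + 2 ≤ Nat.card H) (g : G) :
    g ∈ subsetProds k S := by
  rw [← card_filter_add_card_filter_not (· ∈ H)] at hS
  rw [← filter_union_filter_not_eq (· ∈ H) S]
  obtain hY3 | hY2 := le_or_gt 3 #{x ∈ S | x ∉ H}
  · exact mem_subsetProds_union_of_three_le_card hH (by simp) (by simp) hS3 hY3 hS hk hkH g
  · exact mem_subsetProds_union_of_card_le_two hH (by simp) (by simp) (by lia) h6 hS hk hkH g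

theorem mem_subsetProds_of_index_two [IsCyclic G] [Finite G] (hH : H.index = 2)
    (h6 : 6 ≤ Nat.card H) (hS : Nat.card H < #S) (hk : 3 ≤ k) (hkH : k + 2 ≤ Nat.card H) (g : G) :
    g ∈ subsetProds k S := by
  classical
  obtain hX3 | hX2 := le_or_gt 3 #{x ∈ S | x ∈ H}
  · exact mem_subsetProds_of_three_le_card_filter_mem hH h6 hX3 hS hk hkH g
  · obtain ⟨t, ht⟩ : ∃ t, t ∉ H := by
      by_contra! h
      simp [(Subgroup.eq_top_iff' H).2 h] at hH
    have htS : 3 ≤ #{x ∈ t • S | x ∈ H} := by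
      have hsplit := card_filter_add_card_filter_not (s := S) (· ∈ H)
      have hle : #{x ∈ S | x ∉ H} ≤ #{x ∈ t • S | x ∈ H} := by
        refine card_le_card_of_injOn (t * ·) (fun x hx => ?_) (mul_right_injective t).injOn
        obtain ⟨hxS, hxH⟩ := mem_filter.1 hx
        refine mem_filter.2 ⟨smul_mem_smul_finset hxS, ?_⟩
        simp [Subgroup.mul_mem_iff_of_index_two hH, ht, hxH]
      lia
    have htg : t ^ k * g ∈ subsetProds k (t • S) :=
      mem_subsetProds_of_three_le_card_filter_mem hH h6 htS
        (by rwa [card_smul_finset]) hk hkH _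
    have := pow_mul_mem_subsetProds_smul t⁻¹ htg
    rwa [inv_smul_smul, inv_pow, inv_mul_cancel_left] at this

end IndexTwo

end SubsetProds

section LinearCode

lemma hammingNorm_add_card_zeros {ι M : Type*} [Fintype ι] [Zero M] [DecidableEq M] (x : ι → M) :
    hammingNorm x + #{i | x i = 0} = Fintype.card ι := by
  have := card_filter_add_card_filter_not (s := univ) fun i => x i = 0
  rwa [card_univ, add_comm] at this

lemma exists_mem_ne_zero_forall_eq_zero {ι F : Type*} [Finite ι] [Field F]
    {C : Submodule F (ι → F)} {T : Finset ι} (hT : #T < Module.finrank F C) :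
    ∃ x ∈ C, x ≠ 0 ∧ ∀ i ∈ T, x i = 0 := by
  have hker : LinearMap.ker ((LinearMap.funLeft F F ((↑) : T → ι)).domRestrict C) ≠ ⊥ :=
    LinearMap.ker_ne_bot_of_finrank_lt (by simpa using hT)
  obtain ⟨x, hx, hx0⟩ := (Submodule.ne_bot_iff _).1 hker
  exact ⟨x, x.2, by simpa using hx0, fun i hi => congrFun (LinearMap.mem_ker.1 hx) ⟨i, hi⟩⟩

variable {F : Type*} [Field F] [DecidableEq F] {n : ℕ} {C : Submodule F (Fin n → F)}
  {x : Fin n → F}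

lemma minDist_le_hammingNorm (hx : x ∈ C) (hx0 : x ≠ 0) : minDist C ≤ hammingNorm x :=
  Nat.sInf_le ⟨x, hx, 0, C.zero_mem, hx0, hammingDist_zero_right x⟩

lemma exists_hammingNorm_eq_minDist (hC : C ≠ ⊥) :
    ∃ x ∈ C, x ≠ 0 ∧ hammingNorm x = minDist C := by
  obtain ⟨z, hz, hz0⟩ := C.ne_bot_iff.1 hC
  have hne : {d | ∃ x ∈ C, ∃ y ∈ C, x ≠ y ∧ hammingDist x y = d}.Nonempty :=
    ⟨_, z, hz, 0, C.zero_mem, hz0, rfl⟩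
  obtain ⟨x, hx, y, hy, hxy, hd⟩ := Nat.sInf_mem hne
  exact ⟨-x + y, C.add_mem (C.neg_mem hx) hy, mt neg_add_eq_zero.1 hxy,
    (hammingDist_eq_hammingNorm x y).symm.trans hd⟩

theorem minDist_add_finrank_le (hC : C ≠ ⊥) : minDist C + Module.finrank F C ≤ n + 1 := by
  have hpos := Submodule.one_le_finrank_iff.2 hC
  have hle : Module.finrank F C ≤ n := by simpa using C.finrank_le
  obtain ⟨T, -, hT⟩ := exists_subset_card_eq (s := (univ : Finset (Fin n)))
    (n := Module.finrank F C - 1) (by rw [card_univ, Fintype.card_fin]; lia)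
  obtain ⟨x, hx, hx0, hxT⟩ := exists_mem_ne_zero_forall_eq_zero (C := C) (T := T) (by lia)
  have hmin := minDist_le_hammingNorm hx hx0
  have hzeros : #T ≤ #{i | x i = 0} := card_le_card fun i hi => by simpa using hxT i hi
  have := (hammingNorm_add_card_zeros x).trans (Fintype.card_fin n)
  lia

theorem isMDS_iff_forall_card_zeros_lt (hC : C ≠ ⊥) :
    IsMDS C ↔ ∀ x ∈ C, x ≠ 0 → #{i | x i = 0} < Module.finrank F C := by
  constructor
  · intro h x hx hx0
    have hmin := minDist_le_hammingNorm hx hx0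
    have := (hammingNorm_add_card_zeros x).trans (Fintype.card_fin n)
    unfold IsMDS at h
    lia
  · intro h
    obtain ⟨x, hx, hx0, hmin⟩ := exists_hammingNorm_eq_minDist hC
    have hlt := h x hx hx0
    have := (hammingNorm_add_card_zeros x).trans (Fintype.card_fin n)
    exact (minDist_add_finrank_le hC).antisymm (by lia)

end LinearCode

section Roots

lemma coeff_zero_prod_X_sub_C {R : Type*} [CommRing R] (T : Finset R) :
    (∏ a ∈ T, (X - C a)).coeff 0 = (-1) ^ #T * ∏ a ∈ T, a := by
  rw [coeff_zero_eq_eval_zero, eval_prod, ← prod_neg]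
  simp

lemma prod_X_sub_C_mem_of_forall_eval_eq_zero {F : Type*} [Field F] {V : Submodule F F[X]}
    {p : F[X]} {T : Finset F} (hp : p ∈ V) (hp0 : p ≠ 0) (hdeg : p.natDegree ≤ #T)
    (hT : ∀ a ∈ T, p.eval a = 0) :
    ∏ a ∈ T, (X - C a) ∈ V := by
  have hdvd : ∏ a ∈ T, (X - C a) ∣ p :=
    prod_dvd_of_coprime (fun a _ b _ hab => pairwise_coprime_X_sub_C Function.injective_id hab)
      fun a ha => dvd_iff_isRoot.2 (hT a ha)
  have hprod : p = C p.leadingCoeff * ∏ a ∈ T, (X - C a) :=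
    eq_leadingCoeff_mul_of_monic_of_dvd_of_natDegree_le (monic_prod_X_sub_C _ T) hdvd
      (by rwa [natDegree_finsetProd_X_sub_C_eq_card])
  rw [hprod, ← smul_eq_C_mul] at hp
  exact (V.smul_mem_iff (leadingCoeff_ne_zero.2 hp0)).1 hp

end Roots

lemma card_le_card_preimage_val_add_one {M : Type*} [GroupWithZero M] (A : Finset M) :
    #A ≤ #(A.preimage Units.val Units.val_injective.injOn) + 1 := by
  classical
  have hsub : A ⊆ insert 0 ((A.preimage Units.val Units.val_injective.injOn).image Units.val) := by
    intro a ha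
    obtain rfl | ha0 := eq_or_ne a 0
    · exact mem_insert_self _ _
    · exact mem_insert_of_mem (mem_image.2 ⟨Units.mk0 a ha0, mem_preimage.2 ha, rfl⟩)
  exact (card_le_card hsub).trans ((card_insert_le _ _).trans (by gcongr; exact card_image_le))

namespace TwistedRSParams

section TwistedPoly

variable {F : Type*} [Field F] {n k ℓ : ℕ} (D : TwistedRSParams F n k ℓ)

/-- The parametrization of the twisted polynomials by their coefficients `f₀, …, f_{k - 1}`. -/
noncomputable def twistedPoly : (Fin k → F) →ₗ[F] F[X] :=
  ∑ i : Fin k, monomial (i : ℕ) ∘ₗ LinearMap.proj i +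
    ∑ j : Fin ℓ, D.η j • monomial (k - 1 + D.t j) ∘ₗ LinearMap.proj (D.h j)

lemma range_twistedPoly : LinearMap.range D.twistedPoly = D.twistedPolys := by
  ext p
  simp only [LinearMap.mem_range, twistedPoly, LinearMap.add_apply, LinearMap.sum_apply,
    LinearMap.smul_apply, LinearMap.comp_apply, LinearMap.proj_apply, smul_monomial, smul_eq_mul]
  simp only [← C_mul_X_pow_eq_monomial]
  exact exists_congr fun f => eq_comm

lemma coeff_twistedPoly (f : Fin k → F) (i : Fin k) : (D.twistedPoly f).coeff i = f i := by
  have htwist : ∀ j, k - 1 + D.t j ≠ i := fun j => by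
    have := D.one_le_t j
    lia
  simp [twistedPoly, coeff_monomial, htwist, ← Fin.ext_iff]

lemma finrank_twistedPolys : Module.finrank F D.twistedPolys = k := by
  have hinj : Function.Injective D.twistedPoly := fun f g hfg => funext fun i => by
    rw [← D.coeff_twistedPoly f, hfg, D.coeff_twistedPoly]
  rw [← range_twistedPoly, LinearMap.finrank_range_of_inj hinj, Module.finrank_fin_fun]

end TwistedPoly

lemma evalMap_apply {F : Type*} [Field F] {n : ℕ} (α : Fin n → F) (p : F[X]) (i : Fin n) :
    evalMap α p i = p.eval (α i) :=
  rfl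

section OneTwist

variable {F : Type*} [Field F] {n k : ℕ} {D : TwistedRSParams F n k 1}

lemma IsTwistOneHookZero.twistedPoly_apply (hD : D.IsTwistOneHookZero) (f : Fin k → F) :
    D.twistedPoly f = ∑ i : Fin k, C (f i) * X ^ (i : ℕ) + C (D.η 0 * f ⟨0, D.k_pos⟩) * X ^ k := by
  have hh : D.h 0 = ⟨0, D.k_pos⟩ := Fin.ext hD.2
  simp [twistedPoly, hD.1, hh, Nat.sub_add_cancel D.k_pos, C_mul_X_pow_eq_monomial,
    smul_monomial, -map_mul]

lemma IsTwistOneHookZero.mem_twistedPolys_iff (hD : D.IsTwistOneHookZero) {p : F[X]} :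
    p ∈ D.twistedPolys ↔ p.natDegree ≤ k ∧ p.coeff k = D.η 0 * p.coeff 0 := by
  rw [← range_twistedPoly, LinearMap.mem_range]
  constructor
  · rintro ⟨f, rfl⟩
    rw [D.coeff_twistedPoly f ⟨0, D.k_pos⟩, hD.twistedPoly_apply]
    constructor
    · exact natDegree_add_le_of_degree_le
        (natDegree_sum_le_of_forall_le _ _ fun i _ => (natDegree_C_mul_X_pow_le _ _).trans i.2.le)
        (natDegree_C_mul_X_pow_le _ _)
    · simp [coeff_X_pow, fun i : Fin k => i.2.ne', -map_mul]
  · rintro ⟨hdeg, hcoeff⟩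
    refine ⟨fun i => p.coeff i, ?_⟩
    conv_rhs => rw [p.as_sum_range_C_mul_X_pow' (Nat.lt_succ_of_le hdeg), sum_range_succ, hcoeff,
      ← Fin.sum_univ_eq_sum_range fun i => C (p.coeff i) * X ^ i]
    exact hD.twistedPoly_apply _

lemma IsTwistOneHookZero.prod_X_sub_C_mem_twistedPolys_iff (hD : D.IsTwistOneHookZero)
    (hη : D.η 0 ≠ 0) {T : Finset F} (hT : #T = k) :
    ∏ a ∈ T, (X - C a) ∈ D.twistedPolys ↔ ∏ a ∈ T, a = (-1) ^ k * (D.η 0)⁻¹ := by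
  have hdeg : (∏ a ∈ T, (X - C a)).natDegree = k := by
    rw [natDegree_finsetProd_X_sub_C_eq_card, hT]
  have hlead : (∏ a ∈ T, (X - C a)).coeff k = 1 := hdeg ▸ monic_prod_X_sub_C _ T
  have hsign : ((-1 : F) ^ k) * (-1) ^ k = 1 := by rw [← mul_pow]; simp
  rw [hD.mem_twistedPolys_iff, hdeg, hlead, coeff_zero_prod_X_sub_C, hT, eq_mul_inv_iff_mul_eq₀ hη]
  constructor
  · rintro ⟨-, h⟩
    linear_combination -(-1 : F) ^ k * h - (D.η 0 * ∏ a ∈ T, a) * hsign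
  · intro h
    exact ⟨le_rfl, by linear_combination -(-1 : F) ^ k * h - hsign⟩

lemma IsTwistOneHookZero.injOn_evalMap (hD : D.IsTwistOneHookZero) :
    Set.InjOn (evalMap D.α) D.twistedPolys := by
  intro p hp r hr hpr
  have hdeg := (hD.mem_twistedPolys_iff.1 (D.twistedPolys.sub_mem hp hr)).1
  refine sub_eq_zero.1 (eq_zero_of_natDegree_lt_card_of_eval_eq_zero _ D.α_injective (fun i => ?_)
    (by simpa using hdeg.trans_lt D.k_lt_n))
  rw [eval_sub, sub_eq_zero]
  exact congrFun hpr i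

lemma IsTwistOneHookZero.finrank_code (hD : D.IsTwistOneHookZero) :
    Module.finrank F D.code = k := by
  rw [code, ← LinearMap.range_domRestrict,
    LinearMap.finrank_range_of_inj (Set.injOn_iff_injective.1 hD.injOn_evalMap),
    finrank_twistedPolys]

lemma IsTwistOneHookZero.code_ne_bot (hD : D.IsTwistOneHookZero) : D.code ≠ ⊥ := by
  intro h
  have hk := hD.finrank_code
  rw [h, finrank_bot] at hk
  exact D.k_pos.ne hk

lemma IsStarTwisted.η_ne_zero (hD : D.IsStarTwisted) : D.η 0 ≠ 0 := by
  obtain ⟨-, G, -, -, u, -, hu⟩ := hD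
  intro h
  rw [h, inv_zero, mul_zero] at hu
  exact u.ne_zero hu

variable [DecidableEq F]

lemma IsTwistOneHookZero.isMDS_code_iff_forall_prod_notMem (hD : D.IsTwistOneHookZero) :
    IsMDS D.code ↔ ∀ T ⊆ univ.image D.α, #T = k → ∏ a ∈ T, (X - C a) ∉ D.twistedPolys := by
  rw [isMDS_iff_forall_card_zeros_lt hD.code_ne_bot, hD.finrank_code]
  constructor
  · intro h T hT hTk hprod
    obtain ⟨U, -, rfl⟩ := subset_image_iff.1 hT
    rw [card_image_of_injective _ D.α_injective] at hTk
    have hne : evalMap D.α (∏ a ∈ U.image D.α, (X - C a)) ≠ 0 := fun h0 =>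
      (monic_prod_X_sub_C _ _).ne_zero
        (hD.injOn_evalMap hprod D.twistedPolys.zero_mem (h0.trans (map_zero _).symm))
    have hzeros : ∀ i ∈ U, evalMap D.α (∏ a ∈ U.image D.α, (X - C a)) i = 0 := fun i hi => by
      rw [evalMap_apply, eval_prod]
      exact prod_eq_zero (mem_image_of_mem D.α hi) (by simp)
    have hle := card_le_card fun i hi => mem_filter.2 ⟨mem_univ i, hzeros i hi⟩
    exact (h _ ⟨_, hprod, rfl⟩ hne).not_ge (hTk.symm.trans_le hle)
  · rintro h _ ⟨p, hp, rfl⟩ hp0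
    by_contra! hk
    obtain ⟨U, hU, hUk⟩ := exists_subset_card_eq hk
    have hTk : #(U.image D.α) = k := by rw [card_image_of_injective _ D.α_injective, hUk]
    refine h (U.image D.α) (image_subset_image (subset_univ U)) hTk ?_
    refine prod_X_sub_C_mem_of_forall_eval_eq_zero hp (fun h0 => hp0 (by rw [h0, map_zero])) ?_ ?_
    · exact (hD.mem_twistedPolys_iff.1 hp).1.trans_eq hTk.symm
    · exact forall_mem_image.2 fun i hi => (mem_filter.1 (hU hi)).2

theorem IsTwistOneHookZero.isMDS_code_iff (hD : D.IsTwistOneHookZero) (hη : D.η 0 ≠ 0) :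
    IsMDS D.code ↔ (-1) ^ k * (D.η 0)⁻¹ ∉ subsetProds k (univ.image D.α) := by
  rw [hD.isMDS_code_iff_forall_prod_notMem, mem_subsetProds]
  push Not
  exact forall₃_congr fun T _ hT => not_congr (hD.prod_X_sub_C_mem_twistedPolys_iff hη hT)

theorem IsStarTwisted.isMDS_code (hD : D.IsStarTwisted) : IsMDS D.code := by
  refine (hD.1.isMDS_code_iff hD.η_ne_zero).2 ?_
  obtain ⟨-, G, -, hα, u, hu, hval⟩ := hD
  rw [← hval, ← mem_subsetProds_preimage_val]
  refine fun h => hu (mem_of_mem_subsetProds (fun v hv => ?_) h)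
  obtain ⟨i, -, hi⟩ := mem_image.1 (mem_preimage.1 hv)
  obtain h0 | ⟨g, hg, hgv⟩ := hα i
  · exact absurd (hi.symm.trans h0) v.ne_zero
  · rwa [← Units.ext (hi.symm.trans hgv)] at hg

end OneTwist

section FiniteField

variable {F : Type*} [Field F] {k : ℕ}

theorem exists_isStarTwisted {H : Subgroup Fˣ} (hH : H ≠ ⊤) (hk0 : 0 < k) (hk : k ≤ Nat.card H) :
    ∃ D : TwistedRSParams F (Nat.card H + 1) k 1, D.IsStarTwisted := by
  have : Finite H := Nat.finite_of_card_ne_zero (hk0.trans_le hk).ne'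
  obtain ⟨u, hu⟩ : ∃ u, u ∉ H := by
    by_contra! h
    exact hH ((Subgroup.eq_top_iff' H).2 h)
  let e : Fin (Nat.card H + 1) ≃ Option H := (Finite.equivFinOfCardEq Finite.card_option).symm
  let α : Option H → F := fun o => o.elim 0 fun g => (g : Fˣ)
  have hα : Function.Injective α := by
    rintro (_ | g) (_ | g') h
    · rfl
    · exact absurd h.symm (g' : Fˣ).ne_zero
    · exact absurd h (g : Fˣ).ne_zero
    · exact congrArg some (Subtype.ext (Units.ext h))
  refine ⟨{ k_pos := hk0, k_lt_n := by lia, ℓ_pos := one_pos, α := α ∘ e,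
            α_injective := hα.comp e.injective, t := fun _ => 1, one_le_t := fun _ => le_rfl,
            t_le := fun _ => by lia, h := fun _ => ⟨0, hk0⟩, η := fun _ => (-1) ^ k * (u : F)⁻¹,
            ht_injective := Function.injective_of_subsingleton _ },
    ⟨rfl, rfl⟩, H, hH, ?_, u, hu, ?_⟩
  · intro i
    simp only [Function.comp_apply]
    obtain _ | g := e i
    · exact Or.inl rfl
    · exact Or.inr ⟨g, g.2, rfl⟩
  · simp only [mul_inv, inv_inv]
    rw [← mul_assoc, ← inv_pow, ← mul_pow]
    simp

variable [Finite F] [DecidableEq F]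

theorem IsTwistOneHookZero.not_isMDS_code {n : ℕ} {D : TwistedRSParams F n k 1}
    (hD : D.IsTwistOneHookZero) (hη : D.η 0 ≠ 0) {H : Subgroup Fˣ} (hH : H.index = 2)
    (h6 : 6 ≤ Nat.card H) (hn : Nat.card H + 1 < n) (hk : 3 ≤ k) (hkH : k + 2 ≤ Nat.card H) :
    ¬ IsMDS D.code := by
  have hcard := card_le_card_preimage_val_add_one (univ.image D.α)
  rw [card_image_of_injective _ D.α_injective, card_univ, Fintype.card_fin] at hcard
  have hmem := mem_subsetProds_preimage_val.1 <|
    mem_subsetProds_of_index_two hH h6 (Nat.lt_of_succ_lt_succ (hn.trans_le hcard)) hk hkH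
      ((-1) ^ k * (Units.mk0 _ hη)⁻¹)
  simpa [hD.isMDS_code_iff hη] using hmem

end FiniteField

end TwistedRSParams

lemma exists_subgroup_units_index_two {F : Type*} [Field F] [Fintype F]
    (hodd : Odd (Fintype.card F)) :
    ∃ H : Subgroup Fˣ, H.index = 2 ∧ 2 * Nat.card H + 1 = Fintype.card F := by
  have hcard : Nat.card Fˣ + 1 = Fintype.card F := by
    rw [Nat.card_units, Nat.card_eq_fintype_card, Nat.sub_add_cancel Fintype.card_pos]
  have hindex : (powMonoidHom 2 : Fˣ →* Fˣ).range.index = 2 := by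
    rw [IsCyclic.index_powMonoidHom_range]
    rw [← hcard, Nat.odd_add_one, Nat.not_odd_iff_even] at hodd
    exact Nat.gcd_eq_right hodd.two_dvd
  refine ⟨_, hindex, ?_⟩
  rw [← hcard, ← Subgroup.index_mul_card (powMonoidHom 2 : Fˣ →* Fˣ).range, hindex]

end

theorem mainTheorem9 {F : Type*} [Field F] [Fintype F] [DecidableEq F] (q k : ℕ)
    (hq : Fintype.card F = q) (hodd : Odd q) (hq13 : 13 ≤ q)
    (hk3 : 3 ≤ k) (hk : k + 2 ≤ (q - 1) / 2) :
    (∀ (n : ℕ) (D : TwistedRSParams F n k 1), (q + 1) / 2 < n →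
      D.IsTwistOneHookZero → D.η 0 ≠ 0 → ¬ IsMDS D.code) ∧
    (∃ D : TwistedRSParams F ((q + 1) / 2) k 1, D.IsStarTwisted ∧ IsMDS D.code) ∧
    IsGreatest {n : ℕ | ∃ D : TwistedRSParams F n k 1,
      D.IsTwistOneHookZero ∧ D.η 0 ≠ 0 ∧ IsMDS D.code} ((q + 1) / 2) := by
  subst hq
  obtain ⟨H, hindex, hcard⟩ := exists_subgroup_units_index_two hodd
  have hH : H ≠ ⊤ := by
    rintro rfl
    simp at hindex
  have hlen : (Fintype.card F + 1) / 2 = Nat.card H + 1 := by lia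
  rw [hlen]
  have hnot : ∀ (n : ℕ) (D : TwistedRSParams F n k 1), Nat.card H + 1 < n →
      D.IsTwistOneHookZero → D.η 0 ≠ 0 → ¬ IsMDS D.code := fun n D hn hD hη =>
    hD.not_isMDS_code hη hindex (by lia) hn hk3 (by lia)
  obtain ⟨D, hD⟩ := TwistedRSParams.exists_isStarTwisted (k := k) hH (by lia) (by lia)
  refine ⟨hnot, ⟨D, hD, hD.isMDS_code⟩, ⟨D, hD.1, hD.η_ne_zero, hD.isMDS_code⟩, ?_⟩
  rintro n ⟨D', hD', hη, hMDS⟩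
  exact not_lt.1 fun hn => hnot n D' hn hD' hη hMDS
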